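/- For a complex $*$-algebra $A$ (unital, with conjugate-linear involution) let $\Sigma^2A=\{\sum_{i=1}^k a_i^*a_i : k\in\mathbb N,\ a_i\in A\}$, and call $b\in A$ hermitian if $b^*=b$. A finite-dimensional $*$-representation of $A$ is a unital $\mathbb C$-algebra homomorphism $\pi\colon A\to M_m(\mathbb C)$, $m\in\mathbb N$, with $\pi(a^*)=\pi(a)^*$ (conjugate transpose) for all $a\in A$. Theorem 6.1 (Schmüdgen; Helton). Let $X$ be a set, finite or infinite. Let $A$ be any of the following $*$-algebras: (1) the group algebra $\mathbb C[F_X]$ of the free group $F_X$ on $X$ (so $F_X=F_n$ if $|X|=n$), with $\left(\sum_g a_g g\right)^*=\sum_g \overline{a_g}\,g^{-1}$; (2) the algebra $\mathbb C\langle y_i,z_i : i\in X\rangle$ of polynomials in non-commuting variables, with the involution determined by $y_i^*=z_i$; (3) the algebra $\mathbb C\langle z_i : i\in X\rangle$ of polynomials in non-commuting variables, with the involution determined by $z_i^*=z_i$. If $b\in A$ is hermitian and $\pi(b)$ is a positive semidefinite matrix for every finite-dimensional $*$-representation $\pi$ of $A$, then $b\in\Sigma^2A$. -/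

import Mathlib

open scoped ComplexOrder

namespace FreeSOS

section StarAlgebras

variable {A : Type*} [Ring A] [StarRing A] [Algebra ℂ A]

/-- The set `Σ² A` of (finite) sums of hermitian squares `∑ aᵢ* aᵢ` in a `*`-algebra. -/
def sumHermSq (A : Type*) [Ring A] [StarRing A] : Set A :=
  {b | ∃ (k : ℕ) (a : Fin k → A), b = ∑ i, star (a i) * a i}

/-- `b` is mapped to a positive semidefinite matrix by every finite-dimensional (unital)
`*`-representation `A → M_m(ℂ)`, the involution on `M_m(ℂ)` being the conjugate transpose. -/
def PosSemidefInFinDimReps (b : A) : Prop :=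
  ∀ (m : ℕ) (π : A →⋆ₐ[ℂ] Matrix (Fin m) (Fin m) ℂ), (π b).PosSemidef

end StarAlgebras

section MonoidAlgebras

variable {M : Type*} [Monoid M]

/-- For an involution `σ` of `M`, the map `∑ a_w w ↦ ∑ conj(a_w) σ(w)` on `ℂ[M]`, that is,
the coefficient of `∑ a_w w` at `w` becomes `conj (a_{σ w})`. -/
noncomputable def conjMap (σ : M ≃ M) (a : MonoidAlgebra ℂ M) : MonoidAlgebra ℂ M :=
  MonoidAlgebra.ofCoeff ((a.coeff.equivMapDomain σ).mapRange (starRingEnd ℂ) (map_zero _))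

theorem conjMap_add (σ : M ≃ M) (a b : MonoidAlgebra ℂ M) :
    conjMap σ (a + b) = conjMap σ a + conjMap σ b := by
  ext w
  simp [conjMap]

theorem conjMap_smul (σ : M ≃ M) (c : ℂ) (a : MonoidAlgebra ℂ M) :
    conjMap σ (c • a) = starRingEnd ℂ c • conjMap σ a := by
  ext w
  simp [conjMap]

theorem conjMap_single (σ : M ≃ M) (w : M) (c : ℂ) :
    conjMap σ (MonoidAlgebra.single w c) = MonoidAlgebra.single (σ w) (starRingEnd ℂ c) := by
  classical
  ext v
  by_cases h : σ w = v <;> simp [conjMap, h]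

/-- The involution `(∑ a_w w)* = ∑ conj(a_w) σ(w)` on `ℂ[M]`, for an anti-multiplicative
involution `σ` of the monoid `M`. -/
noncomputable abbrev starRingOf (σ : M ≃ M) (hinv : ∀ w, σ (σ w) = w)
    (hmul : ∀ v w, σ (v * w) = σ w * σ v) : StarRing (MonoidAlgebra ℂ M) where
  star := conjMap σ
  star_involutive a := by
    have h : ∀ w, σ.symm w = σ w := fun w => by rw [Equiv.symm_apply_eq, hinv]
    ext w
    simp [conjMap, h, hinv]
  star_add := conjMap_add σ
  star_mul a b := by
    induction a using MonoidAlgebra.induction_linear with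
    | zero => simp [show conjMap σ 0 = 0 by ext w; simp [conjMap]]
    | add a a' h h' => rw [add_mul, conjMap_add, h, h', conjMap_add, mul_add]
    | single v c =>
      induction b using MonoidAlgebra.induction_linear with
      | zero => simp [show conjMap σ 0 = 0 by ext w; simp [conjMap]]
      | add a a' h h' => rw [mul_add, conjMap_add, h, h', conjMap_add, add_mul]
      | single w d =>
        simp [conjMap_single, MonoidAlgebra.single_mul_single, hmul, mul_comm]

end MonoidAlgebras

section GroupAlgebra

variable {G : Type*} [Group G]

/-- The involution `(∑ a_g g)* = ∑ conj(a_g) g⁻¹` of the group algebra `ℂ[G]`. -/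
noncomputable instance groupAlgebraStarRing : StarRing (MonoidAlgebra ℂ G) :=
  starRingOf (Equiv.inv G) inv_inv mul_inv_rev

theorem groupAlgebra_star_single (g : G) (c : ℂ) :
    star (MonoidAlgebra.single g c) = MonoidAlgebra.single g⁻¹ (starRingEnd ℂ c) :=
  conjMap_single _ g c

end GroupAlgebra

section FreeAlgebras

variable {X : Type*}

/-- Reversal of words. -/
def wordRev (X : Type*) : FreeMonoid X ≃ FreeMonoid X where
  toFun w := FreeMonoid.ofList w.toList.reverse
  invFun w := FreeMonoid.ofList w.toList.reverse
  left_inv w := by simp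
  right_inv w := by simp

/-- Reversal of words, together with the exchange of the letters `y_i = inl i` and
`z_i = inr i`. -/
def wordRevSwap (X : Type*) : FreeMonoid (X ⊕ X) ≃ FreeMonoid (X ⊕ X) where
  toFun w := FreeMonoid.ofList (w.toList.map Sum.swap).reverse
  invFun w := FreeMonoid.ofList (w.toList.map Sum.swap).reverse
  left_inv w := by simp
  right_inv w := by simp

/-- The algebra `ℂ⟨z_i : i ∈ X⟩` of polynomials in non-commuting variables, regarded as a
`*`-algebra with `z_i* = z_i`. -/
def HermFreeAlgebra (X : Type*) : Type _ := MonoidAlgebra ℂ (FreeMonoid X)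

namespace HermFreeAlgebra

noncomputable instance : Ring (HermFreeAlgebra X) :=
  inferInstanceAs (Ring (MonoidAlgebra ℂ (FreeMonoid X)))

noncomputable instance : Algebra ℂ (HermFreeAlgebra X) :=
  inferInstanceAs (Algebra ℂ (MonoidAlgebra ℂ (FreeMonoid X)))

noncomputable instance : StarRing (HermFreeAlgebra X) :=
  starRingOf (wordRev X) (fun w => by simp [wordRev])
    (fun v w => by simp [wordRev])

/-- The variable `z_i`. -/
noncomputable def z (i : X) : HermFreeAlgebra X := MonoidAlgebra.single (FreeMonoid.of i) (1 : ℂ)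

theorem star_z (i : X) : star (z i) = z i :=
  (conjMap_single (wordRev X) (FreeMonoid.of i) 1).trans (by simp [wordRev, z])

theorem star_smul (c : ℂ) (a : HermFreeAlgebra X) : star (c • a) = starRingEnd ℂ c • star a :=
  conjMap_smul (wordRev X) c a

end HermFreeAlgebra

/-- The algebra `ℂ⟨y_i, z_i : i ∈ X⟩` of polynomials in non-commuting variables, regarded as a
`*`-algebra with `y_i* = z_i`. -/
def PairFreeAlgebra (X : Type*) : Type _ := MonoidAlgebra ℂ (FreeMonoid (X ⊕ X))

namespace PairFreeAlgebra

noncomputable instance : Ring (PairFreeAlgebra X) :=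
  inferInstanceAs (Ring (MonoidAlgebra ℂ (FreeMonoid (X ⊕ X))))

noncomputable instance : Algebra ℂ (PairFreeAlgebra X) :=
  inferInstanceAs (Algebra ℂ (MonoidAlgebra ℂ (FreeMonoid (X ⊕ X))))

noncomputable instance : StarRing (PairFreeAlgebra X) :=
  starRingOf (wordRevSwap X) (fun w => by simp [wordRevSwap])
    (fun v w => by simp [wordRevSwap])

/-- The variable `y_i`. -/
noncomputable def y (i : X) : PairFreeAlgebra X :=
  MonoidAlgebra.single (FreeMonoid.of (Sum.inl i)) (1 : ℂ)

/-- The variable `z_i`. -/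
noncomputable def z (i : X) : PairFreeAlgebra X :=
  MonoidAlgebra.single (FreeMonoid.of (Sum.inr i)) (1 : ℂ)

theorem star_y (i : X) : star (y i) = z i :=
  (conjMap_single (wordRevSwap X) (FreeMonoid.of (Sum.inl i)) 1).trans
    (by simp [wordRevSwap, z])

theorem star_smul (c : ℂ) (a : PairFreeAlgebra X) : star (c • a) = starRingEnd ℂ c • star a :=
  conjMap_smul (wordRevSwap X) c a

end PairFreeAlgebra

end FreeAlgebras

end FreeSOS

/-!
If `b` is not a sum of hermitian squares, then, since sums of squares cannot cancel, `b` is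
separated from them by a hermitian functional `l` with `l b < 0` that is strictly positive on the
nonzero squares from a given finite-dimensional subspace `V`. Take `V` to contain `b` and to be
generated from `1` by left multiplication with generators, without leaving `V` (in terms of words:
the span of a suffix-closed set), and equip it with the inner product `⟨v, w⟩ = l (v* w)`.
Multiplication by a generator is only partially defined on `V`. For the group algebra it is a
partial isometry, which extends to a unitary of `V`; for the free algebras one uses its compression
to `V`. As the generators are free, these operators define a `*`-representation `π` on `V`, and
`π b 1 = b` because all intermediate products stay in `V`. Hence `⟨1, π b 1⟩ = l b < 0`.
-/

namespace FreeSOS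

section Convexity

open Module

variable {E : Type*} [AddCommGroup E] [Module ℝ E]

theorem vectorSpan_le_span (K : Set E) : vectorSpan ℝ K ≤ Submodule.span ℝ K := by
  rw [vectorSpan_def, Submodule.span_le]
  rintro _ ⟨x, hx, y, hy, rfl⟩
  exact Submodule.sub_mem _ (Submodule.subset_span hx) (Submodule.subset_span hy)

theorem isCompact_convexHull [TopologicalSpace E] [ContinuousAdd E] [ContinuousSMul ℝ E]
    {K : Set E} (hK : IsCompact K) [FiniteDimensional ℝ (Submodule.span ℝ K)] :
    IsCompact (convexHull ℝ K) := by
  let combination (n : ℕ) (p : (Fin n → ℝ) × (Fin n → E)) : E := ∑ i, p.1 i • p.2 i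
  -- Carathéodory: boundedly many points suffice in each convex combination.
  have hull_eq : convexHull ℝ K = ⋃ n ∈ Set.Iic (finrank ℝ (Submodule.span ℝ K) + 1),
      combination n '' (stdSimplex ℝ (Fin n) ×ˢ Set.univ.pi fun _ => K) := by
    refine Set.Subset.antisymm (fun x hx => ?_) (Set.iUnion₂_subset fun n _ => ?_)
    · obtain ⟨ι, _, z, w, hzK, hz, hw, hw1, rfl⟩ := eq_pos_convex_span_of_mem_convexHull hx
      have card_le : Fintype.card ι ≤ finrank ℝ (Submodule.span ℝ K) + 1 :=
        hz.card_le_finrank_succ.trans <| Nat.succ_le_succ <| Submodule.finrank_mono <|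
          (vectorSpan_mono ℝ hzK).trans (vectorSpan_le_span K)
      let e := Fintype.equivFin ι
      refine Set.mem_biUnion card_le ⟨(w ∘ e.symm, z ∘ e.symm), ⟨⟨fun i => (hw _).le, ?_⟩,
        fun i _ => hzK ⟨_, rfl⟩⟩, e.symm.sum_comp fun i => w i • z i⟩
      exact (e.symm.sum_comp w).trans hw1
    · rintro _ ⟨⟨w, z⟩, ⟨⟨hw, hw1⟩, hz⟩, rfl⟩
      exact (convex_convexHull ℝ K).sum_mem (fun i _ => hw i) hw1
        fun i _ => subset_convexHull ℝ K (hz i trivial)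
  rw [hull_eq]
  exact (Set.finite_Iic _).isCompact_biUnion fun n _ =>
    ((isCompact_stdSimplex ℝ (Fin n)).prod (isCompact_univ_pi fun _ => hK)).image
      (by fun_prop)

theorem exists_dual_pos_of_zero_notMem_convexHull [TopologicalSpace E] [T2Space E]
    [IsTopologicalAddGroup E] [ContinuousSMul ℝ E] [LocallyConvexSpace ℝ E] {K : Set E}
    (hK : IsCompact K) [FiniteDimensional ℝ (Submodule.span ℝ K)] (h0 : 0 ∉ convexHull ℝ K) :
    ∃ f : Dual ℝ E, ∀ x ∈ K, 0 < f x := by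
  obtain ⟨f, r, hr, hf⟩ := geometric_hahn_banach_point_closed (convex_convexHull ℝ K)
    (isCompact_convexHull hK).isClosed h0
  rw [map_zero] at hr
  exact ⟨f, fun x hx => hr.trans (hf x (subset_convexHull ℝ K hx))⟩

variable (E) in
theorem exists_locallyConvexSpace : ∃ _ : TopologicalSpace E,
    T2Space E ∧ IsTopologicalAddGroup E ∧ ContinuousSMul ℝ E ∧ LocallyConvexSpace ℝ E := by
  let B := Dual.eval ℝ E
  exact ⟨inferInstanceAs (TopologicalSpace (WeakBilin B)),
    (WeakBilin.isEmbedding (eval_apply_injective ℝ)).t2Space,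
    inferInstanceAs (IsTopologicalAddGroup (WeakBilin B)),
    inferInstanceAs (ContinuousSMul ℝ (WeakBilin B)),
    inferInstanceAs (LocallyConvexSpace ℝ (WeakBilin B))⟩

theorem exists_dual_pos_of_bilinear {F : Type*} [AddCommGroup F] [Module ℝ F]
    [FiniteDimensional ℝ F] (B : F →ₗ[ℝ] F →ₗ[ℝ] E) (b : E)
    (h0 : 0 ∉ convexHull ℝ (insert b {y | ∃ x ≠ 0, B x x = y})) :
    ∃ f : Dual ℝ E, 0 < f b ∧ ∀ x ≠ 0, 0 < f (B x x) := by
  obtain ⟨_, _, _, _, _⟩ := exists_locallyConvexSpace E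
  let e := finBasis ℝ F
  let q (x : Fin (finrank ℝ F) → ℝ) : E := B (e.equivFun.symm x) (e.equivFun.symm x)
  have continuous_q : Continuous q := by
    simp only [q, e.equivFun_symm_apply, map_sum, map_smul, LinearMap.sum_apply,
      LinearMap.smul_apply]
    fun_prop
  let K := insert b (q '' Metric.sphere 0 1)
  have compact_K : IsCompact K := ((isCompact_sphere 0 1).image continuous_q).insert b
  have span_K_le : Submodule.span ℝ K ≤ Submodule.span ℝ {b} ⊔ Submodule.map₂ B ⊤ ⊤ := by
    refine Submodule.span_le.2 (Set.insert_subset ?_ ?_)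
    · exact Submodule.mem_sup_left (Submodule.mem_span_singleton_self b)
    · rintro _ ⟨x, -, rfl⟩
      exact Submodule.mem_sup_right (Submodule.apply_mem_map₂ _ trivial trivial)
  have : FiniteDimensional ℝ (Submodule.span ℝ K) := by
    have : FiniteDimensional ℝ ↥(Submodule.span ℝ {b} ⊔ Submodule.map₂ B ⊤ ⊤) :=
      Module.Finite.iff_fg.2 ((Submodule.fg_span_singleton b).sup
        (.map₂ B Module.Finite.fg_top Module.Finite.fg_top))
    exact Submodule.finiteDimensional_of_le span_K_le
  have K_subset : K ⊆ insert b {y | ∃ x ≠ 0, B x x = y} := by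
    refine Set.insert_subset_insert ?_
    rintro _ ⟨x, hx, rfl⟩
    exact ⟨_, (map_ne_zero_iff _ (LinearEquiv.injective _)).2
      (ne_zero_of_mem_unit_sphere ⟨x, hx⟩), rfl⟩
  obtain ⟨f, hf⟩ := exists_dual_pos_of_zero_notMem_convexHull compact_K
    fun h => h0 (convexHull_mono K_subset h)
  refine ⟨f, hf _ (Set.mem_insert _ _), fun x hx => ?_⟩
  have hx' : e.equivFun x ≠ 0 := e.equivFun.map_ne_zero_iff.2 hx
  have hpos : 0 < f (q (‖e.equivFun x‖⁻¹ • e.equivFun x)) :=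
    hf _ (.inr ⟨_, mem_sphere_zero_iff_norm.2 (norm_smul_inv_norm (𝕜 := ℝ) hx'), rfl⟩)
  simp only [q, map_smul, LinearEquiv.symm_apply_apply, LinearMap.smul_apply, smul_eq_mul] at hpos
  have := norm_pos_iff.2 hx'
  exact pos_of_mul_pos_right (pos_of_mul_pos_right hpos (by positivity)) (by positivity)

end Convexity

section SumsOfSquares

open Module ComplexStarModule

variable {A : Type*} [Ring A] [StarRing A]

theorem star_mul_self_mem_sumHermSq (a : A) : star a * a ∈ sumHermSq A :=
  ⟨1, fun _ => a, by simp⟩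

theorem add_mem_sumHermSq {b c : A} (hb : b ∈ sumHermSq A) (hc : c ∈ sumHermSq A) :
    b + c ∈ sumHermSq A := by
  obtain ⟨m, a, rfl⟩ := hb
  obtain ⟨n, a', rfl⟩ := hc
  exact ⟨m + n, Fin.append a a', by simp [Fin.sum_univ_add]⟩

/-- The involution of `A` is positive definite (or proper of every order) if a sum of hermitian
squares `∑ aᵢ* aᵢ` vanishes only when all the `aᵢ` do. -/
def HasPositiveDefiniteInvolution (A : Type*) [Ring A] [StarRing A] : Prop :=
  ∀ (k : ℕ) (a : Fin k → A), ∑ i, star (a i) * a i = 0 → a = 0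

theorem HasPositiveDefiniteInvolution.eq_zero_of_add_eq_zero
    (hA : HasPositiveDefiniteInvolution A) {b c : A} (hb : b ∈ sumHermSq A)
    (hc : c ∈ sumHermSq A) (h : b + c = 0) : b = 0 := by
  obtain ⟨m, a, rfl⟩ := hb
  obtain ⟨n, a', rfl⟩ := hc
  have append_eq_zero : Fin.append a a' = 0 := hA _ _ (by simpa [Fin.sum_univ_add] using h)
  refine Finset.sum_eq_zero fun i _ => ?_
  rw [← Fin.append_left a a' i, append_eq_zero, Pi.zero_apply, mul_zero]

theorem HasPositiveDefiniteInvolution.star_mul_self_ne_zero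
    (hA : HasPositiveDefiniteInvolution A) {a : A} (ha : a ≠ 0) : star a * a ≠ 0 :=
  fun h => ha (congrFun (hA 1 (fun _ => a) (by simpa using h)) 0)

variable [Algebra ℂ A] [StarModule ℂ A]

theorem smul_mem_sumHermSq {r : ℝ} (hr : 0 ≤ r) {b : A} (hb : b ∈ sumHermSq A) :
    r • b ∈ sumHermSq A := by
  obtain ⟨k, a, rfl⟩ := hb
  refine ⟨k, fun i => √r • a i, ?_⟩
  simp only [star_smul, star_trivial, smul_mul_smul_comm, Real.mul_self_sqrt hr, Finset.smul_sum]

theorem HasPositiveDefiniteInvolution.convex_sumHermSq_diff_zero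
    (hA : HasPositiveDefiniteInvolution A) : Convex ℝ (sumHermSq A \ {0}) := by
  rintro b ⟨hb, hb0⟩ c ⟨hc, hc0⟩ s t hs ht hst
  have hsb := smul_mem_sumHermSq hs hb
  have htc := smul_mem_sumHermSq ht hc
  refine ⟨add_mem_sumHermSq hsb htc, fun h => ?_⟩
  have hs0 : s = 0 := (smul_eq_zero.1 (hA.eq_zero_of_add_eq_zero hsb htc h)).resolve_right hb0
  have ht0 : t = 0 := (smul_eq_zero.1
    (hA.eq_zero_of_add_eq_zero htc hsb (add_comm (t • c) _ ▸ h))).resolve_right hc0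
  simp [hs0, ht0] at hst

theorem HasPositiveDefiniteInvolution.zero_notMem_convexHull
    (hA : HasPositiveDefiniteInvolution A) {b : A} (hb : b ∉ sumHermSq A) :
    0 ∉ convexHull ℝ (insert (-b) (sumHermSq A \ {0})) := by
  have hb0 : b ≠ 0 := fun h => hb ⟨0, 0, by simpa using h⟩
  have nonempty : (sumHermSq A \ {0}).Nonempty :=
    ⟨_, star_mul_self_mem_sumHermSq b, hA.star_mul_self_ne_zero hb0⟩
  rw [convexHull_insert nonempty, hA.convex_sumHermSq_diff_zero.convexHull_eq,
    convexJoin_singleton_left, Set.mem_iUnion₂]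
  rintro ⟨c, ⟨hc, hc0⟩, s, t, hs, ht, hst, h⟩
  have smul_b : s • b = t • c := by
    rwa [smul_neg, neg_add_eq_zero] at h
  have hs0 : s ≠ 0 := by
    rintro rfl
    rw [zero_add] at hst
    simp_all
  apply hb
  rw [← inv_smul_smul₀ hs0 b, smul_b]
  exact smul_mem_sumHermSq (inv_nonneg.2 hs) (smul_mem_sumHermSq ht hc)

theorem exists_hermitian_extension (f : Dual ℝ A) :
    ∃ l : A →ₗ[ℂ] ℂ, (∀ a, l (star a) = star (l a)) ∧ ∀ a, star a = a → l a = f a := by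
  let l : A →ₗ[ℂ] ℂ :=
    Dual.extendRCLike (f ∘ₗ (selfAdjoint.submodule ℝ A).subtype ∘ₗ realPart)
  have l_apply (a : A) : l a = f (ℜ a) + Complex.I * f (ℑ a) := by
    change (f (ℜ a) : ℂ) - Complex.I * f (ℜ (Complex.I • a)) = _
    simp [realPart_I_smul]
  refine ⟨l, fun a => ?_, fun a ha => ?_⟩
  · have realPart_star : (ℜ (star a) : A) = ℜ a := by simp [realPart_apply_coe, add_comm]
    have imaginaryPart_star : (ℑ (star a) : A) = -ℑ a := by
      simp [imaginaryPart_apply_coe, ← smul_neg]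
    simp [l_apply, realPart_star, imaginaryPart_star]
  · have ha' : IsSelfAdjoint a := ha
    simp [l_apply, ha'.coe_realPart, ha'.imaginaryPart]

theorem HasPositiveDefiniteInvolution.exists_separating_functional
    (hA : HasPositiveDefiniteInvolution A) (V : Submodule ℂ A) [FiniteDimensional ℂ V] {b : A}
    (hb_star : star b = b) (hb : b ∉ sumHermSq A) :
    ∃ l : A →ₗ[ℂ] ℂ, (∀ a, l (star a) = star (l a)) ∧
      (∀ v ∈ V, v ≠ 0 → 0 < l (star v * v)) ∧ l b < 0 := by
  have : FiniteDimensional ℝ V := .complexToReal V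
  let B : V →ₗ[ℝ] V →ₗ[ℝ] A := LinearMap.mk₂ ℝ (fun v w => star (v : A) * w)
    (by simp [add_mul]) (by simp) (by simp [mul_add]) (by simp)
  have subset : {y | ∃ v ≠ 0, B v v = y} ⊆ sumHermSq A \ {0} := by
    rintro _ ⟨v, hv, rfl⟩
    exact ⟨star_mul_self_mem_sumHermSq _, hA.star_mul_self_ne_zero (by simpa using hv)⟩
  obtain ⟨f, hfb, hfV⟩ := exists_dual_pos_of_bilinear B (-b)
    fun h => hA.zero_notMem_convexHull hb (convexHull_mono (Set.insert_subset_insert subset) h)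
  obtain ⟨l, hl, hlf⟩ := exists_hermitian_extension f
  refine ⟨l, hl, fun v hv hv0 => ?_, ?_⟩
  · rw [hlf _ (by simp)]
    exact_mod_cast hfV ⟨v, hv⟩ (by simpa using hv0)
  · rw [hlf b hb_star]
    exact_mod_cast neg_pos.1 (map_neg f b ▸ hfb)

end SumsOfSquares

section GNS

open Module

variable {A : Type*} [Ring A] [StarRing A] [Algebra ℂ A]
  {E : Type*} [NormedAddCommGroup E] [InnerProductSpace ℂ E]

/-- `j` identifies the Hilbert space `E` with a subspace of `A` on which the sesquilinear form
`l (x* y)` is an inner product, that is, with a piece of the GNS space of `l`. -/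
def IsGNSEmbedding (l : A →ₗ[ℂ] ℂ) (j : E →ₗ[ℂ] A) : Prop :=
  ∀ x y, inner ℂ x y = l (star (j x) * j y)

theorem exists_gnsEmbedding [StarModule ℂ A] {l : A →ₗ[ℂ] ℂ} (hl : ∀ a, l (star a) = star (l a))
    (V : Submodule ℂ A) [FiniteDimensional ℂ V] (hV : ∀ v ∈ V, v ≠ 0 → 0 < l (star v * v)) :
    ∃ (n : ℕ) (j : EuclideanSpace ℂ (Fin n) →ₗ[ℂ] A),
      LinearMap.range j = V ∧ IsGNSEmbedding l j := by
  let core : InnerProductSpace.Core ℂ V :=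
    { inner v w := l (star (v : A) * w)
      conj_inner_symm v w := by rw [starRingEnd_apply, ← hl, star_mul, star_star]
      re_inner_nonneg v := by
        rcases eq_or_ne v 0 with rfl | hv
        · simp
        · exact (Complex.pos_iff.1 (hV v v.2 (by simpa using hv))).1.le
      add_left v w w' := by simp [add_mul]
      smul_left v w r := by simp
      definite v h := by
        by_contra hv
        exact (hV v v.2 (by simpa using hv)).ne' h }
  let _ : NormedAddCommGroup V := core.toNormedAddCommGroup
  let _ : InnerProductSpace ℂ V := .ofCore core.toCore
  let e := (stdOrthonormalBasis ℂ V).repr.symm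
  exact ⟨_, V.subtype ∘ₗ e.toLinearEquiv.toLinearMap, by simp [LinearMap.range_comp],
    fun x y => (e.inner_map_map x y).symm⟩

variable [FiniteDimensional ℂ E]

namespace IsGNSEmbedding

variable [StarModule ℂ A] {l : A →ₗ[ℂ] ℂ} {j : E →ₗ[ℂ] A}

theorem exists_projection (hj : IsGNSEmbedding l j) :
    ∃ P : A →ₗ[ℂ] E, (∀ x a, inner ℂ x (P a) = l (star (j x) * a)) ∧ ∀ x, P (j x) = x := by
  let e := stdOrthonormalBasis ℂ E
  let P : A →ₗ[ℂ] E := ∑ i, (l ∘ₗ LinearMap.mulLeft ℂ (star (j (e i)))).smulRight (e i)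
  have inner_P (x : E) (a : A) : inner ℂ x (P a) = l (star (j x) * a) := by
    conv_rhs => rw [← e.sum_repr x]
    simp [P, e.repr_apply_apply, Finset.sum_mul, mul_comm]
  exact ⟨P, inner_P, fun x => ext_inner_left ℂ fun y => (inner_P y (j x)).trans (hj y x).symm⟩

theorem exists_compression (hj : IsGNSEmbedding l j) (hl : ∀ a, l (star a) = star (l a)) :
    ∃ T : A → E →ₗ[ℂ] E, (∀ a, T (star a) = star (T a)) ∧
      ∀ a x x', j x' = a * j x → T a x = x' := by
  obtain ⟨P, inner_P, hPj⟩ := hj.exists_projection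
  refine ⟨fun a => P ∘ₗ LinearMap.mulLeft ℂ a ∘ₗ j, fun a => ?_, fun a x x' h => ?_⟩
  · rw [LinearMap.star_eq_adjoint, LinearMap.eq_adjoint_iff]
    intro x y
    rw [← inner_conj_symm, starRingEnd_apply]
    simp only [LinearMap.comp_apply, LinearMap.mulLeft_apply, inner_P, ← hl, star_mul, star_star,
      mul_assoc]
  · simp [← h, hPj]

theorem exists_unitary (hj : IsGNSEmbedding l j) {u : A} (hu : star u * u = 1) :
    ∃ U : unitary (E →ₗ[ℂ] E), ∀ x x', j x' = u * j x → (U : E →ₗ[ℂ] E) x = x' := by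
  obtain ⟨P, -, hPj⟩ := hj.exists_projection
  let D : Submodule ℂ E := (LinearMap.range j).comap (LinearMap.mulLeft ℂ u ∘ₗ j)
  let S : D →ₗ[ℂ] E := P ∘ₗ LinearMap.mulLeft ℂ u ∘ₗ j ∘ₗ D.subtype
  have inner_S (x y : D) : inner ℂ (S x) (S y) = inner ℂ x y := by
    obtain ⟨⟨x, x', hx⟩, ⟨y, y', hy⟩⟩ := x, y
    have hSx : S ⟨x, x', hx⟩ = x' := (congrArg P hx.symm).trans (hPj x')
    have hSy : S ⟨y, y', hy⟩ = y' := (congrArg P hy.symm).trans (hPj y')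
    rw [hSx, hSy, hj, hx, hy, Submodule.coe_inner, hj]
    simp only [LinearMap.comp_apply, LinearMap.mulLeft_apply, star_mul]
    rw [mul_assoc, ← mul_assoc (star u), hu, one_mul]
  let U : E →ₗᵢ[ℂ] E := (S.isometryOfInner inner_S).extend
  have star_mul_self : star U.toLinearMap * U.toLinearMap = 1 := by
    ext x
    refine ext_inner_left ℂ fun y => ?_
    simp [LinearMap.star_eq_adjoint, LinearMap.adjoint_inner_right]
  refine ⟨⟨U.toLinearMap, star_mul_self, mul_eq_one_comm.1 star_mul_self⟩, fun x x' h => ?_⟩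
  have hUx := (S.isometryOfInner inner_S).extend_apply ⟨x, x', h⟩
  exact hUx.trans (by simp [S, ← h, hPj])

end IsGNSEmbedding

theorem PosSemidefInFinDimReps.inner_nonneg {b : A}
    (hb : PosSemidefInFinDimReps b) (π : A →⋆ₐ[ℂ] (E →ₗ[ℂ] E)) (x : E) :
    0 ≤ inner ℂ x (π b x) := by
  let e := stdOrthonormalBasis ℂ E
  have h := hb _ ((LinearMap.toMatrixOrthonormal e).toStarAlgHom.comp π)
  exact ((LinearMap.posSemidef_toMatrix_iff e).1 h).inner_nonneg_right x

end GNS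

section CyclicSubspaces

variable {A : Type*} [Ring A] [Algebra ℂ A]

/-- `V` is generated by `1` under partial left multiplication by the elements of `G`: a subspace
containing `1`, and containing `g * w ∈ V` whenever it contains `w ∈ V`, contains `V`. This plays
the role of the span of a suffix-closed set of words. -/
structure IsCyclicSubspace (G : Set A) (V : Submodule ℂ A) : Prop where
  one_mem : 1 ∈ V
  le_of_mul_mem (W : Submodule ℂ A) (one_mem : 1 ∈ W)
    (mul_mem : ∀ g ∈ G, ∀ w ∈ V, w ∈ W → g * w ∈ V → g * w ∈ W) : V ≤ W

namespace IsCyclicSubspace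

variable {G : Set A} {V V' : Submodule ℂ A}

theorem span_one (G : Set A) : IsCyclicSubspace G (Submodule.span ℂ {1}) where
  one_mem := Submodule.mem_span_singleton_self 1
  le_of_mul_mem _ one_mem _ := (Submodule.span_singleton_le_iff_mem _ _).2 one_mem

theorem sup (hV : IsCyclicSubspace G V) (hV' : IsCyclicSubspace G V') :
    IsCyclicSubspace G (V ⊔ V') where
  one_mem := Submodule.mem_sup_left hV.one_mem
  le_of_mul_mem W one_mem mul_mem := sup_le
    (hV.le_of_mul_mem W one_mem fun g hg w hw hwW hgw =>
      mul_mem g hg w (Submodule.mem_sup_left hw) hwW (Submodule.mem_sup_left hgw))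
    (hV'.le_of_mul_mem W one_mem fun g hg w hw hwW hgw =>
      mul_mem g hg w (Submodule.mem_sup_right hw) hwW (Submodule.mem_sup_right hgw))

theorem sup_map_mulLeft (hV : IsCyclicSubspace G V) {g : A} (hg : g ∈ G) :
    IsCyclicSubspace G (V ⊔ V.map (LinearMap.mulLeft ℂ g)) where
  one_mem := Submodule.mem_sup_left hV.one_mem
  le_of_mul_mem W one_mem mul_mem := by
    have hVW : V ≤ W := hV.le_of_mul_mem W one_mem fun g hg w hw hwW hgw =>
      mul_mem g hg w (Submodule.mem_sup_left hw) hwW (Submodule.mem_sup_left hgw)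
    refine sup_le hVW ?_
    rintro _ ⟨v, hv, rfl⟩
    exact mul_mem g hg v (Submodule.mem_sup_left hv) (hVW hv)
      (Submodule.mem_sup_right (Submodule.mem_map_of_mem hv))

theorem exists_mul_mem {a : A} (ha : a ∈ Algebra.adjoin ℂ G) (hV : IsCyclicSubspace G V)
    [FiniteDimensional ℂ V] {v : A} (hv : v ∈ V) :
    ∃ V' : Submodule ℂ A, IsCyclicSubspace G V' ∧ FiniteDimensional ℂ V' ∧ a * v ∈ V' := by
  induction ha using Algebra.adjoin_induction generalizing V v with
  | mem g hg =>
    exact ⟨_, hV.sup_map_mulLeft hg, inferInstance,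
      Submodule.mem_sup_right (Submodule.mem_map_of_mem hv)⟩
  | algebraMap c =>
    exact ⟨V, hV, inferInstance, by simpa [← Algebra.smul_def] using V.smul_mem c hv⟩
  | add a a' _ _ ih ih' =>
    obtain ⟨V₁, hV₁, _, hav⟩ := ih hV hv
    obtain ⟨V₂, hV₂, _, hav'⟩ := ih' hV hv
    exact ⟨_, hV₁.sup hV₂, inferInstance, add_mul a a' v ▸
      add_mem (Submodule.mem_sup_left hav) (Submodule.mem_sup_right hav')⟩
  | mul a a' _ _ ih ih' =>
    obtain ⟨V₁, hV₁, _, hav⟩ := ih' hV hv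
    exact mul_assoc a a' v ▸ ih hV₁ hav

theorem exists_mem (hG : Algebra.adjoin ℂ G = ⊤) (a : A) :
    ∃ V : Submodule ℂ A, IsCyclicSubspace G V ∧ FiniteDimensional ℂ V ∧ a ∈ V := by
  simpa using exists_mul_mem (hG ▸ Algebra.mem_top : a ∈ Algebra.adjoin ℂ G) (span_one G)
    (Submodule.mem_span_singleton_self 1)

theorem apply_cyclic_vector {E : Type*} [AddCommGroup E] [Module ℂ E]
    {j : E →ₗ[ℂ] A} (hj : IsCyclicSubspace G (LinearMap.range j)) (π : A →ₐ[ℂ] (E →ₗ[ℂ] E))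
    (hπ : ∀ g ∈ G, ∀ x x', j x' = g * j x → π g x = x') {x₁ : E} (hx₁ : j x₁ = 1) {a : A}
    (ha : a ∈ LinearMap.range j) : j (π a x₁) = a := by
  let W : Submodule ℂ A := LinearMap.eqLocus (j ∘ₗ LinearMap.applyₗ x₁ ∘ₗ π.toLinearMap) .id
  refine hj.le_of_mul_mem W (show j (π 1 x₁) = 1 by simpa) ?_ ha
  rintro g hg w - (hw : j (π w x₁) = w) ⟨x', hx'⟩
  have hgw : π g (π w x₁) = x' := hπ g hg _ _ (by rw [hx', hw])
  change j (π (g * w) x₁) = g * w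
  rw [map_mul, Module.End.mul_apply, hgw, hx']

end IsCyclicSubspace

end CyclicSubspaces

section Criterion

variable {A : Type*} [Ring A] [StarRing A] [Algebra ℂ A] {G : Set A}

/-- Left multiplication by the elements of `G` on each finite-dimensional piece of a GNS space of
`A`, where it is only partially defined, is extended by a `*`-representation of `A` on that piece.
-/
def HasGNSDilations (G : Set A) : Prop :=
  ∀ (n : ℕ) (l : A →ₗ[ℂ] ℂ) (j : EuclideanSpace ℂ (Fin n) →ₗ[ℂ] A),
    (∀ a, l (star a) = star (l a)) → IsGNSEmbedding l j →
      ∃ π : A →⋆ₐ[ℂ] (EuclideanSpace ℂ (Fin n) →ₗ[ℂ] EuclideanSpace ℂ (Fin n)),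
        ∀ g ∈ G, ∀ x x', j x' = g * j x → π g x = x'

theorem mem_sumHermSq_of_posSemidefInFinDimReps [StarModule ℂ A]
    (hA : HasPositiveDefiniteInvolution A) (hG : Algebra.adjoin ℂ G = ⊤)
    (hdil : HasGNSDilations G) {b : A} (hb_star : star b = b) (hb : PosSemidefInFinDimReps b) :
    b ∈ sumHermSq A := by
  by_contra hb_sum
  obtain ⟨V, hV, _, hbV⟩ := IsCyclicSubspace.exists_mem hG b
  obtain ⟨l, hl, hlV, hlb⟩ := hA.exists_separating_functional V hb_star hb_sum
  obtain ⟨n, j, rfl, hj⟩ := exists_gnsEmbedding hl V hlV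
  obtain ⟨π, hπ⟩ := hdil n l j hl hj
  obtain ⟨x₁, hx₁⟩ := hV.one_mem
  have j_apply : j (π b x₁) = b := hV.apply_cyclic_vector π.toAlgHom hπ hx₁ hbV
  have l_b : l b = inner ℂ x₁ (π b x₁) := by rw [hj, hx₁, j_apply, star_one, one_mul]
  exact (l_b ▸ hb.inner_nonneg π x₁).not_gt hlb

end Criterion

section Extension

variable {A : Type*} [Ring A] [StarRing A] [Algebra ℂ A] [StarModule ℂ A]
  {B : Type*} [Ring B] [StarRing B] [Algebra ℂ B] [StarModule ℂ B] {G : Set A}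

theorem map_star_of_adjoin_eq_top (hG : Algebra.adjoin ℂ G = ⊤) (π : A →ₐ[ℂ] B)
    (hπ : ∀ g ∈ G, π (star g) = star (π g)) (a : A) : π (star a) = star (π a) := by
  have ha : a ∈ Algebra.adjoin ℂ G := hG ▸ Algebra.mem_top
  induction ha using Algebra.adjoin_induction with
  | mem g hg => exact hπ g hg
  | algebraMap c => simp [← algebraMap_star_comm]
  | add a a' _ _ ih ih' => rw [star_add, map_add, ih, ih', map_add, star_add]
  | mul a a' _ _ ih ih' => rw [star_mul, map_mul, ih, ih', map_mul, star_mul]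

end Extension

section MonoidAlgebras

open MonoidAlgebra

variable {M : Type*} [Monoid M]

theorem adjoin_of_image_eq_top {S : Set M} (hS : Submonoid.closure S = ⊤) :
    Algebra.adjoin ℂ (of ℂ M '' S) = ⊤ := by
  have closure_le : Submonoid.closure S ≤
      (Algebra.adjoin ℂ (of ℂ M '' S)).toSubmonoid.comap (of ℂ M) :=
    Submonoid.closure_le.2 fun s hs => Algebra.subset_adjoin (Set.mem_image_of_mem _ hs)
  refine eq_top_iff.2 fun a _ => Algebra.adjoin_le ?_ (mem_adjoin_support a)
  rintro _ ⟨w, -, rfl⟩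
  exact closure_le (hS ▸ Submonoid.mem_top w)

variable [StarRing (MonoidAlgebra ℂ M)] {σ : M → M}

theorem coeff_star_mul_self [DecidableEq M]
    (hσ : ∀ w c, star (single w c : MonoidAlgebra ℂ M) = single (σ w) (star c))
    (a : MonoidAlgebra ℂ M) {x : M}
    (hx : ∀ u ∈ a.coeff.support, ∀ v ∈ a.coeff.support, σ u * v = x → u = v) :
    (star a * a).coeff x =
      ((∑ u ∈ a.coeff.support with σ u * u = x, ‖a.coeff u‖ ^ 2 : ℝ) : ℂ) := by
  have expand : star a * a = ∑ u ∈ a.coeff.support, ∑ v ∈ a.coeff.support,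
      single (σ u * v) (star (a.coeff u) * a.coeff v) := by
    conv_lhs => rw [← a.sum_coeff_single, Finsupp.sum]
    simp only [star_sum, hσ, Finset.sum_mul_sum, single_mul_single]
  rw [expand, Finset.sum_filter]
  simp only [coeff_sum, Finsupp.finsetSum_apply, coeff_single, Finsupp.single_apply,
    Complex.ofReal_sum]
  refine Finset.sum_congr rfl fun u hu => ?_
  rw [Finset.sum_eq_single_of_mem u hu fun v hv hvu => if_neg fun h => hvu (hx u hu v hv h).symm]
  split_ifs <;> simp [← Complex.conj_mul']

theorem hasPositiveDefiniteInvolution_of_exists_leading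
    (hσ : ∀ w c, star (single w c : MonoidAlgebra ℂ M) = single (σ w) (star c))
    (hlead : ∀ T : Finset M, T.Nonempty →
      ∃ w ∈ T, ∀ u ∈ T, ∀ v ∈ T, σ u * v = σ w * w → u = v) :
    HasPositiveDefiniteInvolution (MonoidAlgebra ℂ M) := by
  classical
  intro k a ha
  by_contra ha0
  let T := Finset.univ.biUnion fun i => (a i).coeff.support
  have support_subset (i : Fin k) : (a i).coeff.support ⊆ T :=
    Finset.subset_biUnion_of_mem (fun i => (a i).coeff.support) (Finset.mem_univ i)
  have nonempty_T : T.Nonempty := by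
    obtain ⟨i, hi⟩ := Function.ne_iff.1 ha0
    exact (Finsupp.support_nonempty_iff.2 (coeff_eq_zero.not.2 hi)).mono (support_subset i)
  obtain ⟨w, hwT, hw⟩ := hlead T nonempty_T
  let r (i : Fin k) : ℝ := ∑ u ∈ (a i).coeff.support with σ u * u = σ w * w, ‖(a i).coeff u‖ ^ 2
  have coeff_eq (i : Fin k) : (star (a i) * a i).coeff (σ w * w) = r i :=
    coeff_star_mul_self hσ _ fun u hu v hv =>
      hw u (support_subset i hu) v (support_subset i hv)
  have sum_r : ∑ i, r i = 0 := by
    have := congrArg (fun b => b.coeff (σ w * w)) ha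
    simpa [coeff_sum, coeff_eq, ← Complex.ofReal_sum] using this
  obtain ⟨i, -, hwi⟩ := Finset.mem_biUnion.1 hwT
  have r_pos : 0 < r i := Finset.sum_pos' (fun _ _ => by positivity)
    ⟨w, Finset.mem_filter.2 ⟨hwi, rfl⟩, by have := Finsupp.mem_support_iff.1 hwi; positivity⟩
  refine r_pos.ne' ((Finset.sum_eq_zero_iff_of_nonneg fun i _ => ?_).1 sum_r i (Finset.mem_univ i))
  exact Finset.sum_nonneg fun _ _ => by positivity

end MonoidAlgebras

section FreeGroups

open MonoidAlgebra

instance {G : Type*} [Group G] : StarModule ℂ (MonoidAlgebra ℂ G) := ⟨conjMap_smul _⟩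

theorem hasPositiveDefiniteInvolution_groupAlgebra (G : Type*) [Group G] :
    HasPositiveDefiniteInvolution (MonoidAlgebra ℂ G) :=
  hasPositiveDefiniteInvolution_of_exists_leading groupAlgebra_star_single fun _ ⟨w, hw⟩ =>
    ⟨w, hw, fun u _ v _ h => by rwa [inv_mul_cancel, inv_mul_eq_one] at h⟩

variable {X : Type*}

theorem unitaryRep_map_star {G : Type*} [Group G] {B : Type*} [Ring B] [StarRing B] [Algebra ℂ B]
    [StarModule ℂ B] (ρ : G →* unitary B) (a : MonoidAlgebra ℂ G) :
    MonoidAlgebra.lift ℂ B G ((unitary B).subtype.comp ρ) (star a) =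
      star (MonoidAlgebra.lift ℂ B G ((unitary B).subtype.comp ρ) a) := by
  refine map_star_of_adjoin_eq_top (adjoin_of_image_eq_top Submonoid.closure_univ) _ ?_ a
  rintro _ ⟨g, -, rfl⟩
  simp [groupAlgebra_star_single, ← Unitary.star_eq_inv]

theorem freeGroup_hasGNSDilations (X : Type*) :
    HasGNSDilations (of ℂ (FreeGroup X) ''
      (Set.range FreeGroup.of ∪ (Set.range FreeGroup.of)⁻¹)) := by
  intro n l j _ hj
  have star_mul_self (g : FreeGroup X) : star (of ℂ _ g) * of ℂ _ g = 1 := by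
    simp [groupAlgebra_star_single, one_def]
  choose U hU using fun x : X => hj.exists_unitary (star_mul_self (FreeGroup.of x))
  let ρ := FreeGroup.lift U
  have ρ_of (s : X) : ∀ x x', j x' = of ℂ _ (FreeGroup.of s) * j x →
      (ρ (FreeGroup.of s) : _ →ₗ[ℂ] _) x = x' :=
    (FreeGroup.lift_apply_of : ρ (FreeGroup.of s) = U s) ▸ hU s
  refine ⟨⟨MonoidAlgebra.lift ℂ _ _ ((unitary _).subtype.comp ρ), unitaryRep_map_star ρ⟩, ?_⟩
  rintro _ ⟨g, hg, rfl⟩ x x' hx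
  suffices h : (ρ g : _ →ₗ[ℂ] _) x = x' by simpa
  obtain ⟨s, rfl⟩ | ⟨s, hs⟩ := hg
  · exact ρ_of s x x' hx
  · have ρ_x' : (ρ (FreeGroup.of s) : _ →ₗ[ℂ] _) x' = x := ρ_of s x' x <| by
      rw [hx, ← mul_assoc, ← map_mul, hs, inv_mul_cancel, map_one, one_mul]
    rw [← ρ_x', ← Module.End.mul_apply, ← Submonoid.coe_mul, ← map_mul, hs, mul_inv_cancel,
      map_one]
    rfl

theorem freeGroup_mem_sumHermSq {X : Type*} {b : MonoidAlgebra ℂ (FreeGroup X)}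
    (hb_star : star b = b) (hb : PosSemidefInFinDimReps b) :
    b ∈ sumHermSq (MonoidAlgebra ℂ (FreeGroup X)) := by
  refine mem_sumHermSq_of_posSemidefInFinDimReps (hasPositiveDefiniteInvolution_groupAlgebra _)
    (adjoin_of_image_eq_top ?_) (freeGroup_hasGNSDilations X) hb_star hb
  rw [← Subgroup.closure_toSubmonoid, FreeGroup.closure_range_of, Subgroup.top_toSubmonoid]

end FreeGroups

section FreeMonoids

open MonoidAlgebra

variable {Y : Type*} [StarRing (MonoidAlgebra ℂ (FreeMonoid Y))] {τ : Y → Y}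

theorem freeMonoid_hasPositiveDefiniteInvolution (hτ : Function.Injective τ)
    (hstar : ∀ w c, star (single w c : MonoidAlgebra ℂ (FreeMonoid Y)) =
      single (FreeMonoid.ofList (w.toList.map τ).reverse) (star c)) :
    HasPositiveDefiniteInvolution (MonoidAlgebra ℂ (FreeMonoid Y)) := by
  refine hasPositiveDefiniteInvolution_of_exists_leading hstar fun T hT => ?_
  obtain ⟨w, hw, longest⟩ := T.exists_max_image FreeMonoid.length hT
  refine ⟨w, hw, fun u hu v hv (h : (u.toList.map τ).reverse ++ v.toList =
    (w.toList.map τ).reverse ++ w.toList) => ?_⟩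
  have length_eq := congrArg List.length h
  have hu' : u.toList.length ≤ w.toList.length := longest u hu
  have hv' : v.toList.length ≤ w.toList.length := longest v hv
  simp only [List.length_append, List.length_reverse, List.length_map] at length_eq
  obtain ⟨hu, hv⟩ := List.append_inj h (by simp; omega)
  have hu : u.toList = w.toList := List.map_injective_iff.2 hτ (List.reverse_injective hu)
  exact FreeMonoid.toList.injective (hu.trans hv.symm)

theorem freeMonoid_hasGNSDilations [StarModule ℂ (MonoidAlgebra ℂ (FreeMonoid Y))]
    (hstar : ∀ w c, star (single w c : MonoidAlgebra ℂ (FreeMonoid Y)) =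
      single (FreeMonoid.ofList (w.toList.map τ).reverse) (star c)) :
    HasGNSDilations (of ℂ (FreeMonoid Y) '' Set.range FreeMonoid.of) := by
  intro n l j hl hj
  obtain ⟨T, star_T, hT⟩ := hj.exists_compression hl
  let π := MonoidAlgebra.lift ℂ _ _ (FreeMonoid.lift fun s => T (of ℂ _ (FreeMonoid.of s)))
  have π_of (s : Y) : π (of ℂ _ (FreeMonoid.of s)) = T (of ℂ _ (FreeMonoid.of s)) := by
    simp [π]
  have map_star (a) : π (star a) = star (π a) := by
    refine map_star_of_adjoin_eq_top (adjoin_of_image_eq_top FreeMonoid.closure_range_of) π ?_ a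
    rintro _ ⟨_, ⟨s, rfl⟩, rfl⟩
    have star_of : star (of ℂ _ (FreeMonoid.of s)) = of ℂ _ (FreeMonoid.of (τ s)) := by
      simp [hstar]
    rw [star_of, π_of, π_of, ← star_T, star_of]
  refine ⟨⟨π, map_star⟩, ?_⟩
  rintro _ ⟨_, ⟨s, rfl⟩, rfl⟩ x x' h
  exact (congrArg (· x) (π_of s)).trans (hT _ _ _ h)

theorem freeMonoid_mem_sumHermSq [StarModule ℂ (MonoidAlgebra ℂ (FreeMonoid Y))]
    (hτ : Function.Injective τ)
    (hstar : ∀ w c, star (single w c : MonoidAlgebra ℂ (FreeMonoid Y)) =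
      single (FreeMonoid.ofList (w.toList.map τ).reverse) (star c))
    {b : MonoidAlgebra ℂ (FreeMonoid Y)} (hb_star : star b = b) (hb : PosSemidefInFinDimReps b) :
    b ∈ sumHermSq (MonoidAlgebra ℂ (FreeMonoid Y)) :=
  mem_sumHermSq_of_posSemidefInFinDimReps (freeMonoid_hasPositiveDefiniteInvolution hτ hstar)
    (adjoin_of_image_eq_top FreeMonoid.closure_range_of) (freeMonoid_hasGNSDilations hstar)
    hb_star hb

end FreeMonoids

section FreeAlgebras

variable {X : Type*}

instance : StarModule ℂ (HermFreeAlgebra X) := ⟨HermFreeAlgebra.star_smul⟩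

instance : StarModule ℂ (PairFreeAlgebra X) := ⟨PairFreeAlgebra.star_smul⟩

theorem HermFreeAlgebra.mem_sumHermSq {b : HermFreeAlgebra X} (hb_star : star b = b)
    (hb : PosSemidefInFinDimReps b) : b ∈ sumHermSq (HermFreeAlgebra X) :=
  let _ : StarRing (MonoidAlgebra ℂ (FreeMonoid X)) :=
    inferInstanceAs (StarRing (HermFreeAlgebra X))
  let _ : StarModule ℂ (MonoidAlgebra ℂ (FreeMonoid X)) :=
    inferInstanceAs (StarModule ℂ (HermFreeAlgebra X))
  freeMonoid_mem_sumHermSq Function.injective_id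
    (fun w c => (conjMap_single (wordRev X) w c).trans (by simp [wordRev])) hb_star hb

theorem PairFreeAlgebra.mem_sumHermSq {b : PairFreeAlgebra X} (hb_star : star b = b)
    (hb : PosSemidefInFinDimReps b) : b ∈ sumHermSq (PairFreeAlgebra X) :=
  let _ : StarRing (MonoidAlgebra ℂ (FreeMonoid (X ⊕ X))) :=
    inferInstanceAs (StarRing (PairFreeAlgebra X))
  let _ : StarModule ℂ (MonoidAlgebra ℂ (FreeMonoid (X ⊕ X))) :=
    inferInstanceAs (StarModule ℂ (PairFreeAlgebra X))
  freeMonoid_mem_sumHermSq Sum.swap_leftInverse.injective (conjMap_single (wordRevSwap X))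
    hb_star hb

end FreeAlgebras

end FreeSOS

theorem theorem6p1 (X : Type*) :
    (∀ b : MonoidAlgebra ℂ (FreeGroup X), star b = b →
      FreeSOS.PosSemidefInFinDimReps b →
        b ∈ FreeSOS.sumHermSq (MonoidAlgebra ℂ (FreeGroup X))) ∧
    (∀ b : FreeSOS.PairFreeAlgebra X, star b = b →
      FreeSOS.PosSemidefInFinDimReps b →
        b ∈ FreeSOS.sumHermSq (FreeSOS.PairFreeAlgebra X)) ∧
    (∀ b : FreeSOS.HermFreeAlgebra X, star b = b →
      FreeSOS.PosSemidefInFinDimReps b →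
        b ∈ FreeSOS.sumHermSq (FreeSOS.HermFreeAlgebra X)) :=
  ⟨fun _ => FreeSOS.freeGroup_mem_sumHermSq, fun _ => FreeSOS.PairFreeAlgebra.mem_sumHermSq,
    fun _ => FreeSOS.HermFreeAlgebra.mem_sumHermSq⟩
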